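/- Let $H$ be a nonzero complex Hilbert space and let $S\subseteq B(H)$ be a concrete operator system, i.e. a linear subspace with $1\in S$ and $s^*\in S$ for all $s\in S$ (neither assumed separable nor norm closed). For a Hilbert space $K$, a linear map $\phi:S\to B(K)$ is completely positive (cp) if for every $n$ the map $(a_{ij})\mapsto(\phi(a_{ij}))$ sends positive elements of $M_n(S)\subseteq M_n(B(H))=B(H^n)$ to positive elements of $M_n(B(K))=B(K^n)$; it is ucp if moreover $\phi(1)=1$. A ucp map $\phi$ is pure if every cp map $\psi:S\to B(K)$ for which $\phi-\psi$ is cp has the form $\psi=t\phi$ with $0\le t\le 1$. A pure matrix state on $S$ is a pure ucp map $S\to M_k=B(\mathbb{C}^k)$ for some $k\ge 1$. (1) For every $s\in S$ there are $k\in\{1,2\}$ and a pure matrix state $\phi:S\to M_k$ such that $\|\phi(s)\|=\|s\|$. (2) For every $n\ge 1$ and every $x=(s_{ij})\in M_n(S)$, where $M_n(S)\subseteq B(H^n)$ is regarded as an operator system, $$\|x\|=\max\{\|\psi(x)\| : \psi \text{ a pure matrix state on } M_n(S)\},$$ that is, the set on the right has a greatest element and it equals $\|x\|$. -/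

import Mathlib

/-- A concrete operator system on a complex Hilbert space `H`: a unital self-adjoint linear
subspace of `B(H)`. It is neither assumed to be norm closed nor to be separable. -/
structure ConcreteOperatorSystem (H : Type*) [NormedAddCommGroup H] [InnerProductSpace ℂ H]
    [CompleteSpace H] extends Submodule ℂ (H →L[ℂ] H) where
  one_mem' : (1 : H →L[ℂ] H) ∈ carrier
  star_mem' : ∀ a : H →L[ℂ] H, a ∈ carrier → star a ∈ carrier

/-- The Hilbert space direct sum `Hⁿ` of `n` copies of `H`. -/
abbrev HilbertPower (H : Type*) (n : ℕ) : Type _ := PiLp 2 (fun _ : Fin n => H)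

/-- The matrix algebra `M_k`, as the algebra `B(ℂᵏ)`; its norm is the operator norm. -/
abbrev MatAlg (k : ℕ) : Type := EuclideanSpace ℂ (Fin k) →L[ℂ] EuclideanSpace ℂ (Fin k)

/-- The identification of `M_n(B(H))` with `B(Hⁿ)`: the operator on `Hⁿ` given by an `n × n` matrix
of operators on `H`. -/
noncomputable def blockOp {H : Type*} [NormedAddCommGroup H] [InnerProductSpace ℂ H] {n : ℕ}
    (a : Matrix (Fin n) (Fin n) (H →L[ℂ] H)) : HilbertPower H n →L[ℂ] HilbertPower H n :=
  ((PiLp.continuousLinearEquiv 2 ℂ (fun _ : Fin n => H)).symm :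
      (Fin n → H) →L[ℂ] HilbertPower H n) ∘L
    ContinuousLinearMap.pi (fun i => ∑ j, a i j ∘L PiLp.proj 2 (fun _ : Fin n => H) j)

theorem blockOp_apply {H : Type*} [NormedAddCommGroup H] [InnerProductSpace ℂ H] {n : ℕ}
    (a : Matrix (Fin n) (Fin n) (H →L[ℂ] H)) (x : HilbertPower H n) (i : Fin n) :
    blockOp a x i = ∑ j, a i j (x j) := by
  simp [blockOp]

theorem blockOp_one {H : Type*} [NormedAddCommGroup H] [InnerProductSpace ℂ H] {n : ℕ} :
    blockOp (1 : Matrix (Fin n) (Fin n) (H →L[ℂ] H)) = 1 := by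
  ext x i
  rw [blockOp_apply, Finset.sum_eq_single i]
  · simp
  · intro j _ hj
    simp [Matrix.one_apply_ne hj.symm]
  · simp

theorem star_blockOp {H : Type*} [NormedAddCommGroup H] [InnerProductSpace ℂ H]
    [CompleteSpace H] {n : ℕ} (a : Matrix (Fin n) (Fin n) (H →L[ℂ] H)) :
    star (blockOp a) = blockOp (star a) := by
  symm
  rw [ContinuousLinearMap.star_eq_adjoint, ContinuousLinearMap.eq_adjoint_iff]
  intro x y
  simp only [PiLp.inner_apply, blockOp_apply, sum_inner, inner_sum, Matrix.star_apply,
    ContinuousLinearMap.star_eq_adjoint, ContinuousLinearMap.adjoint_inner_left]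
  exact Finset.sum_comm

namespace ConcreteOperatorSystem

/-- The operator system `M_n(S) ⊆ M_n(B(H)) = B(Hⁿ)` of all `n × n` matrices with entries in `S`. -/
noncomputable def matrixSystem {H : Type*} [NormedAddCommGroup H] [InnerProductSpace ℂ H]
    [CompleteSpace H] (S : ConcreteOperatorSystem H) (n : ℕ) :
    ConcreteOperatorSystem (HilbertPower H n) where
  carrier := {T | ∃ a : Matrix (Fin n) (Fin n) (H →L[ℂ] H),
    (∀ i j, a i j ∈ S.toSubmodule) ∧ blockOp a = T}
  zero_mem' := ⟨0, fun _ _ => S.toSubmodule.zero_mem, by ext x i; simp [blockOp_apply]⟩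
  add_mem' := by
    rintro _ _ ⟨a, ha, rfl⟩ ⟨b, hb, rfl⟩
    refine ⟨a + b, fun i j => S.toSubmodule.add_mem (ha i j) (hb i j), ?_⟩
    ext x i
    simp [blockOp_apply, Finset.sum_add_distrib]
  smul_mem' := by
    rintro c _ ⟨a, ha, rfl⟩
    refine ⟨c • a, fun i j => S.toSubmodule.smul_mem c (ha i j), ?_⟩
    ext x i
    simp [blockOp_apply, Finset.smul_sum]
  one_mem' := by
    refine ⟨1, fun i j => ?_, blockOp_one⟩
    by_cases h : i = j
    · subst h
      rw [Matrix.one_apply_eq]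
      exact S.one_mem'
    · rw [Matrix.one_apply_ne h]
      exact S.toSubmodule.zero_mem
  star_mem' := by
    rintro _ ⟨a, ha, rfl⟩
    exact ⟨star a, fun i j => S.star_mem' _ (ha j i), (star_blockOp a).symm⟩

/-- `φ : S → B(K)` is completely positive: for every `n`, the map
`(a i j) ↦ (φ (a i j))` from `M_n(S) ⊆ B(Hⁿ)` to `M_n(B(K)) = B(Kⁿ)` is positive. -/
def IsCP {H K : Type*} [NormedAddCommGroup H] [InnerProductSpace ℂ H] [CompleteSpace H]
    [NormedAddCommGroup K] [InnerProductSpace ℂ K] [CompleteSpace K]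
    (S : ConcreteOperatorSystem H) (φ : S.toSubmodule →ₗ[ℂ] (K →L[ℂ] K)) : Prop :=
  ∀ (n : ℕ) (a : Matrix (Fin n) (Fin n) S.toSubmodule),
    0 ≤ blockOp (a.map (fun x => (x : H →L[ℂ] H))) → 0 ≤ blockOp (a.map φ)

/-- `φ : S → B(K)` is unital and completely positive. -/
def IsUCP {H K : Type*} [NormedAddCommGroup H] [InnerProductSpace ℂ H] [CompleteSpace H]
    [NormedAddCommGroup K] [InnerProductSpace ℂ K] [CompleteSpace K]
    (S : ConcreteOperatorSystem H) (φ : S.toSubmodule →ₗ[ℂ] (K →L[ℂ] K)) : Prop :=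
  S.IsCP φ ∧ φ ⟨1, S.one_mem'⟩ = 1

/-- `φ : S → B(K)` is a pure ucp map: every cp map `ψ` with `φ - ψ` cp is `t φ` for some
`t ∈ [0, 1]`. -/
def IsPureUCP {H K : Type*} [NormedAddCommGroup H] [InnerProductSpace ℂ H] [CompleteSpace H]
    [NormedAddCommGroup K] [InnerProductSpace ℂ K] [CompleteSpace K]
    (S : ConcreteOperatorSystem H) (φ : S.toSubmodule →ₗ[ℂ] (K →L[ℂ] K)) : Prop :=
  S.IsUCP φ ∧ ∀ ψ : S.toSubmodule →ₗ[ℂ] (K →L[ℂ] K), S.IsCP ψ → S.IsCP (φ - ψ) →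
    ∃ t : ℝ, 0 ≤ t ∧ t ≤ 1 ∧ ψ = (t : ℂ) • φ

/-- The set `𝒫_k(S)` of pure matrix states `S → M_k`. -/
def pureMatrixStates {H : Type*} [NormedAddCommGroup H] [InnerProductSpace ℂ H]
    [CompleteSpace H] (S : ConcreteOperatorSystem H) (k : ℕ) :
    Set (S.toSubmodule →ₗ[ℂ] MatAlg k) :=
  {φ | S.IsPureUCP φ}

end ConcreteOperatorSystem

/-! ### Positivity of operators and of block operators. -/

open scoped ComplexOrder InnerProductSpace

/-! The norm of `s` is the supremum of `Re ⟪u, s v⟫` over unit vectors, and this number is an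
off-diagonal entry of the compression of `s` to `M₂` along `u, v`. Such compressions lie in the set
`cpTraceTwo` of cp maps `S → M₂` with `Tr φ(1) = 2`, which is compact for pointwise convergence.
Hence the real part of that entry attains its maximum, at least `‖s‖`, at an extreme point `φ`
(`exists_extreme_norm_le_reUpperRight`).

Extremality under the trace normalization says that every cp map dominated by `φ` is a multiple of
`φ` (`IsCP.eq_smul_of_mem_extremePoints`). Factor `φ(1) = V* V` with `V` onto `ℂᵏ`, `k ≤ 2`. Then `φ
= V* ψ V` with `ψ` ucp, and `ψ` inherits purity. As `‖V e₀‖² + ‖V e₁‖² = 2`, the entry of `φ(s)` is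
at most `‖ψ(s)‖`, while ucp maps are contractive; so `‖ψ(s)‖ = ‖s‖`. The second claim is this result
for `M_n(S)`, together with contractivity. -/

theorem ContinuousLinearMap.nonneg_iff_inner_right {H : Type*} [NormedAddCommGroup H]
    [InnerProductSpace ℂ H] [CompleteSpace H] {T : H →L[ℂ] H} :
    0 ≤ T ↔ ∀ x, 0 ≤ ⟪x, T x⟫_ℂ := by
  rw [ContinuousLinearMap.nonneg_iff_isPositive]
  refine ⟨fun h x => h.inner_nonneg_right x, fun h => ?_⟩
  rw [ContinuousLinearMap.isPositive_iff_complex]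
  intro x
  have h3 := Complex.le_def.1 (h x)
  have h4 : ⟪T x, x⟫_ℂ = ⟪x, T x⟫_ℂ := by
    rw [← inner_conj_symm]
    exact Complex.conj_eq_iff_im.2 h3.2.symm
  rw [h4]
  exact ⟨Complex.ext rfl h3.2, h3.1⟩

theorem inner_self_eq_ofReal_norm_sq {H : Type*} [NormedAddCommGroup H] [InnerProductSpace ℂ H]
    (x : H) : ⟪x, x⟫_ℂ = ((‖x‖ ^ 2 : ℝ) : ℂ) := by
  rw [inner_self_eq_norm_sq_to_K]
  push_cast
  rfl

theorem blockOp_nonneg_iff {H : Type*} [NormedAddCommGroup H] [InnerProductSpace ℂ H]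
    [CompleteSpace H] {n : ℕ} (a : Matrix (Fin n) (Fin n) (H →L[ℂ] H)) :
    0 ≤ blockOp a ↔ ∀ x : Fin n → H, 0 ≤ ∑ i, ∑ j, ⟪x i, a i j (x j)⟫_ℂ := by
  have key (x : HilbertPower H n) :
      ⟪x, blockOp a x⟫_ℂ = ∑ i, ∑ j, ⟪x i, a i j (x j)⟫_ℂ := by
    simp only [PiLp.inner_apply, blockOp_apply, inner_sum]
  simp only [ContinuousLinearMap.nonneg_iff_inner_right, key]
  exact ⟨fun h x => h (WithLp.toLp 2 x), fun h x => h x⟩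

theorem nonpos_of_forall_mul_le {q M : ℝ} (h : ∀ c : ℝ, c * q ≤ M) : q ≤ 0 := by
  by_contra! hq
  have := h ((M + 1) / q)
  rw [div_mul_cancel₀ _ hq.ne'] at this
  linarith

/-! ### Completely positive maps: compressions, norm bounds, kernels. -/

namespace ConcreteOperatorSystem

variable {H K L : Type*} [NormedAddCommGroup H] [InnerProductSpace ℂ H] [CompleteSpace H]
  [NormedAddCommGroup K] [InnerProductSpace ℂ K] [CompleteSpace K]
  [NormedAddCommGroup L] [InnerProductSpace ℂ L] [CompleteSpace L]
  {S : ConcreteOperatorSystem H}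

theorem isCP_iff {φ : S.toSubmodule →ₗ[ℂ] (K →L[ℂ] K)} :
    S.IsCP φ ↔ ∀ (n : ℕ) (a : Matrix (Fin n) (Fin n) S.toSubmodule),
      0 ≤ blockOp (a.map (fun x => (x : H →L[ℂ] H))) →
        ∀ x : Fin n → K, 0 ≤ ∑ i, ∑ j, ⟪x i, φ (a i j) (x j)⟫_ℂ := by
  simp only [IsCP, blockOp_nonneg_iff, Matrix.map_apply]

/-- The compression `a ↦ V* φ(a) V` of a linear map `φ : S → B(K)` by `V : L → K`. -/
noncomputable def compress (φ : S.toSubmodule →ₗ[ℂ] (K →L[ℂ] K)) (V : L →L[ℂ] K) :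
    S.toSubmodule →ₗ[ℂ] (L →L[ℂ] L) where
  toFun a := ContinuousLinearMap.adjoint V ∘L φ a ∘L V
  map_add' a b := by ext; simp
  map_smul' c a := by ext; simp

theorem inner_compress (φ : S.toSubmodule →ₗ[ℂ] (K →L[ℂ] K)) (V : L →L[ℂ] K)
    (a : S.toSubmodule) (x y : L) : ⟪x, compress φ V a y⟫_ℂ = ⟪V x, φ a (V y)⟫_ℂ := by
  simp [compress, ContinuousLinearMap.adjoint_inner_right]

theorem compress_sub (φ ψ : S.toSubmodule →ₗ[ℂ] (K →L[ℂ] K)) (V : L →L[ℂ] K) :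
    compress (φ - ψ) V = compress φ V - compress ψ V := by
  ext a x
  simp [compress]

theorem compress_smul (c : ℂ) (φ : S.toSubmodule →ₗ[ℂ] (K →L[ℂ] K)) (V : L →L[ℂ] K) :
    compress (c • φ) V = c • compress φ V := by
  ext a x
  simp [compress]

theorem compress_compress_of_comp_eq_id (φ : S.toSubmodule →ₗ[ℂ] (K →L[ℂ] K)) {V : L →L[ℂ] K}
    {W : K →L[ℂ] L} (h : ∀ x, V (W x) = x) : compress (compress φ V) W = φ := by
  ext a x
  refine ext_inner_left ℂ fun y => ?_
  rw [inner_compress, inner_compress, h, h]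

theorem IsCP.compress {φ : S.toSubmodule →ₗ[ℂ] (K →L[ℂ] K)} (h : S.IsCP φ) (V : L →L[ℂ] K) :
    S.IsCP (compress φ V) := by
  rw [isCP_iff] at h ⊢
  intro n a ha x
  simpa only [inner_compress] using h n a ha fun i => V (x i)

theorem isCP_subtype (S : ConcreteOperatorSystem H) : S.IsCP S.toSubmodule.subtype :=
  fun _ _ ha => ha

theorem IsCP.smul {φ : S.toSubmodule →ₗ[ℂ] (K →L[ℂ] K)} (h : S.IsCP φ) {r : ℝ} (hr : 0 ≤ r) :
    S.IsCP ((r : ℂ) • φ) := by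
  rw [isCP_iff] at h ⊢
  intro n a ha x
  have := mul_nonneg (Complex.zero_le_real.2 hr) (h n a ha x)
  simpa [inner_smul_right, Finset.mul_sum] using this

theorem IsCP.inner_map_one_nonneg {φ : S.toSubmodule →ₗ[ℂ] (K →L[ℂ] K)} (h : S.IsCP φ) (x : K) :
    0 ≤ ⟪x, φ ⟨1, S.one_mem'⟩ x⟫_ℂ := by
  have := isCP_iff.1 h 1 !![⟨1, S.one_mem'⟩] ?_ fun _ => x
  · simpa using this
  · rw [blockOp_nonneg_iff]
    intro y
    simp

theorem IsCP.map_one_nonneg {φ : S.toSubmodule →ₗ[ℂ] (K →L[ℂ] K)} (h : S.IsCP φ) :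
    0 ≤ φ ⟨1, S.one_mem'⟩ :=
  ContinuousLinearMap.nonneg_iff_inner_right.2 h.inner_map_one_nonneg

/-- The cross terms are at most `2‖a‖‖x₀‖‖x₁‖ ≤ ‖a‖(‖x₀‖² + ‖x₁‖²)` in absolute value. -/
theorem blockOp_norm_nonneg (a : H →L[ℂ] H) :
    0 ≤ blockOp (!![(‖a‖ : ℂ) • (1 : H →L[ℂ] H), a; star a, (‖a‖ : ℂ) • 1]) := by
  rw [blockOp_nonneg_iff]
  intro x
  have e : ⟪x 1, (star a) (x 0)⟫_ℂ = (starRingEnd ℂ) ⟪x 0, a (x 1)⟫_ℂ := by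
    rw [ContinuousLinearMap.star_eq_adjoint, ContinuousLinearMap.adjoint_inner_right,
      inner_conj_symm]
  simp only [Fin.sum_univ_two, Matrix.of_apply, Matrix.cons_val', Matrix.cons_val_zero,
    Matrix.cons_val_one, Matrix.cons_val_fin_one, smul_apply, inner_smul_right, one_apply_eq_self,
    inner_self_eq_ofReal_norm_sq, ← Complex.ofReal_mul, e]
  have hb : |(⟪x 0, a (x 1)⟫_ℂ).re| ≤ ‖a‖ * (‖x 0‖ * ‖x 1‖) := by
    calc |(⟪x 0, a (x 1)⟫_ℂ).re| ≤ ‖⟪x 0, a (x 1)⟫_ℂ‖ := Complex.abs_re_le_norm _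
      _ ≤ ‖x 0‖ * ‖a (x 1)‖ := norm_inner_le_norm _ _
      _ ≤ ‖x 0‖ * (‖a‖ * ‖x 1‖) := by gcongr; exact a.le_opNorm _
      _ = _ := by ring
  rw [Complex.le_def]
  constructor
  · simp only [Complex.add_re, Complex.ofReal_re, Complex.conj_re, Complex.zero_re]
    nlinarith [neg_abs_le (⟪x 0, a (x 1)⟫_ℂ).re,
      mul_nonneg (norm_nonneg a) (sq_nonneg (‖x 0‖ - ‖x 1‖))]
  · simp only [Complex.add_im, Complex.ofReal_im, Complex.conj_im, Complex.zero_im]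
    ring

/-- Complete positivity for `n = 2`, applied to the matrix of `blockOp_norm_nonneg`. This inequality
yields both the norm bounds and the kernel lemmas. -/
theorem IsCP.two_mul_re_inner_le {φ : S.toSubmodule →ₗ[ℂ] (K →L[ℂ] K)} (h : S.IsCP φ)
    (a : S.toSubmodule) (x y : K) :
    2 * (⟪x, φ a y⟫_ℂ).re ≤ ‖(a : H →L[ℂ] H)‖ *
      ((⟪x, φ ⟨1, S.one_mem'⟩ x⟫_ℂ).re + (⟪y, φ ⟨1, S.one_mem'⟩ y⟫_ℂ).re) := by
  set r := ‖(a : H →L[ℂ] H)‖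
  set u : S.toSubmodule := ⟨1, S.one_mem'⟩
  set b : S.toSubmodule := ⟨star (a : H →L[ℂ] H), S.star_mem' _ a.2⟩
  have key (y : K) : 0 ≤ (r : ℂ) * ⟪x, φ u x⟫_ℂ + ⟪x, φ a y⟫_ℂ + ⟪y, φ b x⟫_ℂ
      + r * ⟪y, φ u y⟫_ℂ := by
    have := isCP_iff.1 h 2 !![(r : ℂ) • u, a; b, (r : ℂ) • u] ?_ ![x, y]
    · simpa [Fin.sum_univ_two, inner_smul_right, add_assoc] using this
    · convert blockOp_norm_nonneg (a : H →L[ℂ] H) using 2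
      ext i j : 2
      fin_cases i <;> fin_cases j <;> rfl
  -- At `-y` the real part gives the estimate. At `I • y` the vanishing imaginary part shows that
  -- `⟪x, φ a y⟫` and `⟪y, φ b x⟫` have equal real parts, so `φ(a*) = φ(a)*` is not needed.
  have h0 := Complex.le_def.1 (key (-y))
  have h1 := Complex.le_def.1 (key (Complex.I • y))
  have hx := Complex.le_def.1 (h.inner_map_one_nonneg x)
  have hy := Complex.le_def.1 (h.inner_map_one_nonneg y)
  simp only [map_smul, inner_smul_left, inner_smul_right, map_neg, inner_neg_left, inner_neg_right,
    neg_neg, Complex.add_re, Complex.add_im, Complex.mul_re, Complex.mul_im, Complex.neg_re,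
    Complex.neg_im, Complex.conj_I, Complex.I_re, Complex.I_im, Complex.ofReal_re,
    Complex.ofReal_im, Complex.zero_re, Complex.zero_im] at h0 h1 hx hy
  obtain ⟨-, h1⟩ := h1
  rw [← hx.2, ← hy.2] at h1
  nlinarith [h0.1]

theorem IsCP.norm_le {φ : S.toSubmodule →ₗ[ℂ] (K →L[ℂ] K)} (h : S.IsCP φ) {c : ℝ} (hc : 0 ≤ c)
    (hφ : ∀ x, (⟪x, φ ⟨1, S.one_mem'⟩ x⟫_ℂ).re ≤ c * ‖x‖ ^ 2) (a : S.toSubmodule) :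
    ‖φ a‖ ≤ c * ‖(a : H →L[ℂ] H)‖ := by
  refine ContinuousLinearMap.opNorm_le_bound _ (by positivity) fun y => ?_
  by_cases hz : φ a y = 0
  · rw [hz, norm_zero]; positivity
  have hz' : 0 < ‖φ a y‖ := norm_pos_iff.2 hz
  have hy : 0 < ‖y‖ := norm_pos_iff.2 fun h0 => hz (by rw [h0, map_zero])
  -- The test vector is `φ a y` rescaled to the norm of `y`.
  have h1 := h.two_mul_re_inner_le a (((‖y‖ / ‖φ a y‖ : ℝ) : ℂ) • φ a y) y
  have h2 := hφ (((‖y‖ / ‖φ a y‖ : ℝ) : ℂ) • φ a y)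
  have h3 : ‖((‖y‖ / ‖φ a y‖ : ℝ) : ℂ) • φ a y‖ = ‖y‖ := by
    rw [norm_smul, Complex.norm_real, Real.norm_of_nonneg (by positivity)]
    field_simp
  have h4 : (⟪((‖y‖ / ‖φ a y‖ : ℝ) : ℂ) • φ a y, φ a y⟫_ℂ).re = ‖y‖ * ‖φ a y‖ := by
    rw [inner_smul_left, inner_self_eq_ofReal_norm_sq, Complex.conj_ofReal, ← Complex.ofReal_mul,
      Complex.ofReal_re]
    field_simp
  rw [h3] at h2
  rw [h4] at h1
  have h5 := mul_le_mul_of_nonneg_left (add_le_add h2 (hφ y)) (norm_nonneg (a : H →L[ℂ] H))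
  have h6 : ‖y‖ * ‖φ a y‖ ≤ ‖y‖ * (c * ‖(a : H →L[ℂ] H)‖ * ‖y‖) := by nlinarith
  exact le_of_mul_le_mul_left h6 hy

theorem IsUCP.norm_le {φ : S.toSubmodule →ₗ[ℂ] (K →L[ℂ] K)} (h : S.IsUCP φ) (a : S.toSubmodule) :
    ‖φ a‖ ≤ ‖(a : H →L[ℂ] H)‖ := by
  have := h.1.norm_le zero_le_one (fun x => ?_) a
  · simpa using this
  · rw [h.2, one_apply_eq_self, one_mul]
    exact (inner_self_eq_norm_sq (𝕜 := ℂ) x).le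

/-- Scaling `x` by a real `c` leaves the right side of `two_mul_re_inner_le` fixed, while the left
side is linear in `c`. -/
theorem IsCP.apply_eq_zero_of_map_one {φ : S.toSubmodule →ₗ[ℂ] (K →L[ℂ] K)} (h : S.IsCP φ) {x : K}
    (hx : φ ⟨1, S.one_mem'⟩ x = 0) (a : S.toSubmodule) : φ a x = 0 := by
  have key := nonpos_of_forall_mul_le (q := 2 * ‖φ a x‖ ^ 2) fun c => by
    have h1 := h.two_mul_re_inner_le a (φ a x) ((c : ℂ) • x)
    rw [map_smul, map_smul, hx, smul_zero, inner_zero_right, inner_smul_right,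
      inner_self_eq_ofReal_norm_sq, ← Complex.ofReal_mul, Complex.ofReal_re] at h1
    exact (mul_left_comm _ _ _).trans_le h1
  rw [← norm_eq_zero, ← sq_eq_zero_iff]
  linarith [sq_nonneg ‖φ a x‖]

theorem IsCP.inner_apply_eq_zero_of_map_one {φ : S.toSubmodule →ₗ[ℂ] (K →L[ℂ] K)} (h : S.IsCP φ)
    {x : K} (hx : φ ⟨1, S.one_mem'⟩ x = 0) (a : S.toSubmodule) (y : K) : ⟪x, φ a y⟫_ℂ = 0 := by
  have key := nonpos_of_forall_mul_le (q := 2 * ‖⟪x, φ a y⟫_ℂ‖ ^ 2) fun c => by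
    have h1 := h.two_mul_re_inner_le a ((c : ℂ) • ⟪x, φ a y⟫_ℂ • x) y
    rw [map_smul, map_smul, hx, smul_zero, smul_zero, inner_zero_right, inner_smul_left,
      inner_smul_left, Complex.conj_ofReal, Complex.conj_mul', ← Complex.ofReal_pow,
      ← Complex.ofReal_mul, Complex.ofReal_re] at h1
    exact (mul_left_comm _ _ _).trans_le h1
  rw [← norm_eq_zero, ← sq_eq_zero_iff]
  linarith [sq_nonneg ‖⟪x, φ a y⟫_ℂ‖]

end ConcreteOperatorSystem

/-! ### Factoring positive matrices and approximating the operator norm. -/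

/-- `V` is the square root of `P`, corestricted to its range in orthonormal coordinates. -/
theorem ContinuousLinearMap.exists_surjective_inner_eq {E : Type*} [NormedAddCommGroup E]
    [InnerProductSpace ℂ E] [FiniteDimensional ℂ E] [CompleteSpace E] {P : E →L[ℂ] E}
    (hP : 0 ≤ P) :
    ∃ k ≤ Module.finrank ℂ E, ∃ V : E →L[ℂ] EuclideanSpace ℂ (Fin k),
      Function.Surjective V ∧ ∀ x y, ⟪x, P y⟫_ℂ = ⟪V x, V y⟫_ℂ := by
  set R := CFC.sqrt P
  have hR : star R = R := (IsSelfAdjoint.of_nonneg (CFC.sqrt_nonneg P)).star_eq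
  let R' : E →ₗ[ℂ] E := R
  let b := stdOrthonormalBasis ℂ (LinearMap.range R')
  refine ⟨_, (LinearMap.range R').finrank_le,
    LinearMap.toContinuousLinearMap (b.repr.toLinearEquiv.toLinearMap ∘ₗ R'.rangeRestrict),
    b.repr.surjective.comp R'.surjective_rangeRestrict, fun x y => ?_⟩
  have h1 : ⟪b.repr (R'.rangeRestrict x), b.repr (R'.rangeRestrict y)⟫_ℂ = ⟪R x, R y⟫_ℂ :=
    b.repr.inner_map_map _ _
  refine Eq.trans ?_ h1.symm
  rw [← ContinuousLinearMap.adjoint_inner_right, ← ContinuousLinearMap.star_eq_adjoint, hR]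
  conv_lhs => rw [← CFC.sqrt_mul_sqrt_self P hP]
  rfl

theorem ContinuousLinearMap.exists_unit_vectors_lt_re_inner {H : Type*} [NormedAddCommGroup H]
    [InnerProductSpace ℂ H] [Nontrivial H] (a : H →L[ℂ] H) {r : ℝ} (hr : r < ‖a‖) :
    ∃ u v : H, ‖u‖ = 1 ∧ ‖v‖ = 1 ∧ r < (⟪u, a v⟫_ℂ).re := by
  by_cases ha : a = 0
  · obtain ⟨u, hu⟩ := exists_norm_eq H zero_le_one
    exact ⟨u, u, hu, hu, by simpa [ha] using hr⟩
  -- The maximum with `0` forces `a x ≠ 0`, so that `a x` can be normalized.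
  obtain ⟨x, hx1, hx2⟩ := a.exists_lt_apply_of_lt_opNorm (max_lt hr (norm_pos_iff.2 ha))
  have hax : 0 < ‖a x‖ := (le_max_right _ _).trans_lt hx2
  have hx : 0 < ‖x‖ := norm_pos_iff.2 fun h => by simp [h] at hax
  refine ⟨((‖a x‖⁻¹ : ℝ) : ℂ) • a x, ((‖x‖⁻¹ : ℝ) : ℂ) • x, ?_, ?_,
    ((le_max_left _ _).trans_lt hx2).trans_le ?_⟩
  · rw [norm_smul, Complex.norm_real, norm_inv, norm_norm, inv_mul_cancel₀ hax.ne']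
  · rw [norm_smul, Complex.norm_real, norm_inv, norm_norm, inv_mul_cancel₀ hx.ne']
  · rw [map_smul, inner_smul_left, inner_smul_right, Complex.conj_ofReal,
      inner_self_eq_ofReal_norm_sq, ← Complex.ofReal_mul, ← Complex.ofReal_mul, Complex.ofReal_re]
    have : ‖a x‖⁻¹ * (‖x‖⁻¹ * ‖a x‖ ^ 2) = ‖x‖⁻¹ * ‖a x‖ := by field_simp
    rw [this]
    exact le_mul_of_one_le_left hax.le ((one_le_inv₀ hx).2 hx1.le)

/-! ### The compact set of trace-two cp maps into `M₂` and its extreme points. -/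

namespace ConcreteOperatorSystem

variable {H : Type*} [NormedAddCommGroup H] [InnerProductSpace ℂ H] [CompleteSpace H]
  {S : ConcreteOperatorSystem H}

/-- The trace of `g 1` for a map `g : S → M₂`. -/
noncomputable def traceAtOne (g : S.toSubmodule → MatAlg 2) : ℝ :=
  (⟪EuclideanSpace.single 0 1, g ⟨1, S.one_mem'⟩ (EuclideanSpace.single 0 1)⟫_ℂ).re +
    (⟪EuclideanSpace.single 1 1, g ⟨1, S.one_mem'⟩ (EuclideanSpace.single 1 1)⟫_ℂ).re

theorem traceAtOne_add (g h : S.toSubmodule → MatAlg 2) :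
    traceAtOne (g + h) = traceAtOne g + traceAtOne h := by
  simp only [traceAtOne, Pi.add_apply, add_apply, inner_add_right, Complex.add_re]
  ring

theorem traceAtOne_smul (r : ℝ) (g : S.toSubmodule → MatAlg 2) :
    traceAtOne ((r : ℂ) • g) = r * traceAtOne g := by
  simp only [traceAtOne, Pi.smul_apply, smul_apply, inner_smul_right, Complex.re_ofReal_mul]
  ring

theorem IsCP.traceAtOne_nonneg {φ : S.toSubmodule →ₗ[ℂ] MatAlg 2} (h : S.IsCP φ) :
    0 ≤ traceAtOne φ :=
  add_nonneg (Complex.le_def.1 (h.inner_map_one_nonneg _)).1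
    (Complex.le_def.1 (h.inner_map_one_nonneg _)).1

/-- Positivity of `φ(1)` at `u - v` bounds its form at `u + v` by twice the diagonal terms. The
factor `2` is not sharp; the bound serves compactness and shows that trace zero forces `φ = 0`. -/
theorem IsCP.norm_le_traceAtOne {φ : S.toSubmodule →ₗ[ℂ] MatAlg 2} (h : S.IsCP φ)
    (a : S.toSubmodule) : ‖φ a‖ ≤ 2 * traceAtOne φ * ‖(a : H →L[ℂ] H)‖ := by
  refine h.norm_le (mul_nonneg zero_le_two h.traceAtOne_nonneg) (fun x => ?_) a
  set P := φ ⟨1, S.one_mem'⟩ with hP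
  have hx : x = x 0 • EuclideanSpace.single 0 1 + x 1 • EuclideanSpace.single 1 1 := by
    ext i
    fin_cases i <;> simp
  have hn : ‖x‖ ^ 2 = ‖x 0‖ ^ 2 + ‖x 1‖ ^ 2 := by
    rw [EuclideanSpace.norm_sq_eq, Fin.sum_univ_two]
  have scale (c : ℂ) (u : EuclideanSpace ℂ (Fin 2)) :
      (⟪c • u, P (c • u)⟫_ℂ).re = ‖c‖ ^ 2 * (⟪u, P u⟫_ℂ).re := by
    rw [map_smul, inner_smul_left, inner_smul_right, ← mul_assoc, Complex.conj_mul',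
      ← Complex.ofReal_pow, Complex.re_ofReal_mul]
  have par (u v : EuclideanSpace ℂ (Fin 2)) :
      (⟪u + v, P (u + v)⟫_ℂ).re ≤ 2 * ((⟪u, P u⟫_ℂ).re + (⟪v, P v⟫_ℂ).re) := by
    have := (Complex.le_def.1 (h.inner_map_one_nonneg (u - v))).1
    rw [← hP] at this
    simp only [map_add, map_sub, inner_add_left, inner_add_right, inner_sub_left, inner_sub_right,
      Complex.add_re, Complex.sub_re, Complex.zero_re] at this ⊢
    linarith
  have h0 := (Complex.le_def.1 (h.inner_map_one_nonneg (EuclideanSpace.single 0 1))).1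
  have h1 := (Complex.le_def.1 (h.inner_map_one_nonneg (EuclideanSpace.single 1 1))).1
  rw [← hP, Complex.zero_re] at h0 h1
  have h2 := par (x 0 • EuclideanSpace.single 0 1) (x 1 • EuclideanSpace.single 1 1)
  rw [← hx, scale, scale] at h2
  rw [hn, traceAtOne, ← hP]
  nlinarith [mul_nonneg h0 (sq_nonneg ‖x 1‖), mul_nonneg h1 (sq_nonneg ‖x 0‖)]

/-- The completely positive maps `φ : S → M₂` with `Tr φ(1) = 2`, as a set of functions. -/
def cpTraceTwo (S : ConcreteOperatorSystem H) : Set (S.toSubmodule → MatAlg 2) :=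
  {g | ∃ φ : S.toSubmodule →ₗ[ℂ] MatAlg 2, S.IsCP φ ∧ traceAtOne φ = 2 ∧ ⇑φ = g}

theorem isClosed_cpTraceTwo (S : ConcreteOperatorSystem H) : IsClosed (cpTraceTwo S) := by
  have e : cpTraceTwo S = {g | (∀ a b, g (a + b) = g a + g b) ∧ (∀ (c : ℂ) a, g (c • a) = c • g a) ∧
      (∀ (n : ℕ) (a : Matrix (Fin n) (Fin n) S.toSubmodule),
        0 ≤ blockOp (a.map (fun x => (x : H →L[ℂ] H))) →
          ∀ x : Fin n → EuclideanSpace ℂ (Fin 2), 0 ≤ ∑ i, ∑ j, ⟪x i, g (a i j) (x j)⟫_ℂ) ∧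
      traceAtOne g = 2} := by
    ext g
    constructor
    · rintro ⟨φ, h1, h2, rfl⟩
      exact ⟨map_add φ, map_smul φ, isCP_iff.1 h1, h2⟩
    · rintro ⟨h1, h2, h3, h4⟩
      exact ⟨{ toFun := g, map_add' := h1, map_smul' := h2 }, isCP_iff.2 h3, h4, rfl⟩
  have cont (a : S.toSubmodule) (x y : EuclideanSpace ℂ (Fin 2)) :
      Continuous fun g : S.toSubmodule → MatAlg 2 => ⟪x, g a y⟫_ℂ := by
    fun_prop
  rw [e]
  refine IsClosed.inter ?_ (IsClosed.inter ?_ (IsClosed.inter ?_ ?_))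
  · change IsClosed {g : S.toSubmodule → MatAlg 2 | ∀ a b, g (a + b) = g a + g b}
    simp only [Set.ofPred_forall]
    exact isClosed_iInter fun a => isClosed_iInter fun b => isClosed_eq (by fun_prop) (by fun_prop)
  · change IsClosed {g : S.toSubmodule → MatAlg 2 | ∀ (c : ℂ) a, g (c • a) = c • g a}
    simp only [Set.ofPred_forall]
    exact isClosed_iInter fun a => isClosed_iInter fun b => isClosed_eq (by fun_prop) (by fun_prop)
  · change IsClosed {g : S.toSubmodule → MatAlg 2 |
      ∀ (n : ℕ) (a : Matrix (Fin n) (Fin n) S.toSubmodule),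
        0 ≤ blockOp (a.map (fun x => (x : H →L[ℂ] H))) →
          ∀ x : Fin n → EuclideanSpace ℂ (Fin 2), 0 ≤ ∑ i, ∑ j, ⟪x i, g (a i j) (x j)⟫_ℂ}
    simp only [Set.ofPred_forall]
    refine isClosed_iInter fun n => isClosed_iInter fun a => isClosed_iInter fun _ =>
      isClosed_iInter fun x => isClosed_le continuous_const ?_
    exact continuous_finsetSum _ fun i _ => continuous_finsetSum _ fun j _ => cont _ _ _
  · exact isClosed_eq ((Complex.continuous_re.comp (cont _ _ _)).add
      (Complex.continuous_re.comp (cont _ _ _))) continuous_const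

theorem isCompact_cpTraceTwo (S : ConcreteOperatorSystem H) : IsCompact (cpTraceTwo S) := by
  refine (isCompact_univ_pi fun a : S.toSubmodule =>
    isCompact_closedBall (0 : MatAlg 2) (2 * 2 * ‖(a : H →L[ℂ] H)‖)).of_isClosed_subset
      (isClosed_cpTraceTwo S) ?_
  rintro _ ⟨φ, h1, h2, rfl⟩ a -
  rw [mem_closedBall_zero_iff]
  exact (h1.norm_le_traceAtOne a).trans_eq (by rw [h2])

/-- The real part of the upper right entry of `g s`, for `g : S → M₂`. -/
noncomputable def reUpperRight (s : S.toSubmodule) : (S.toSubmodule → MatAlg 2) →L[ℝ] ℝ where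
  toFun g := (⟪EuclideanSpace.single 0 1, g s (EuclideanSpace.single 1 1)⟫_ℂ).re
  map_add' g h := by simp only [Pi.add_apply, add_apply, inner_add_right, Complex.add_re]
  map_smul' r g := by
    simp only [Pi.smul_apply, smul_apply, inner_smul_right_eq_smul, Complex.real_smul,
      Complex.re_ofReal_mul, RingHom.id_apply, smul_eq_mul]
  cont := by fun_prop

theorem reUpperRight_apply (s : S.toSubmodule) (g : S.toSubmodule → MatAlg 2) :
    reUpperRight s g = (⟪EuclideanSpace.single 0 1, g s (EuclideanSpace.single 1 1)⟫_ℂ).re :=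
  rfl

theorem exists_mem_cpTraceTwo_lt [Nontrivial H] (s : S.toSubmodule) {r : ℝ}
    (hr : r < ‖(s : H →L[ℂ] H)‖) : ∃ g ∈ cpTraceTwo S, r < reUpperRight s g := by
  obtain ⟨u, v, hu, hv, h⟩ := ContinuousLinearMap.exists_unit_vectors_lt_re_inner (s : H →L[ℂ] H) hr
  let V : EuclideanSpace ℂ (Fin 2) →L[ℂ] H := LinearMap.toContinuousLinearMap
    { toFun := fun x => x 0 • u + x 1 • v
      map_add' := fun x y => by simp only [PiLp.add_apply, add_smul]; abel
      map_smul' := fun c x => by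
        simp only [PiLp.smul_apply, smul_eq_mul, mul_smul, smul_add, RingHom.id_apply] }
  have h0 : V (EuclideanSpace.single 0 1) = u := by
    change (EuclideanSpace.single (0 : Fin 2) (1 : ℂ)) 0 • u +
      (EuclideanSpace.single (0 : Fin 2) (1 : ℂ)) 1 • v = u
    simp
  have h1 : V (EuclideanSpace.single 1 1) = v := by
    change (EuclideanSpace.single (1 : Fin 2) (1 : ℂ)) 0 • u +
      (EuclideanSpace.single (1 : Fin 2) (1 : ℂ)) 1 • v = v
    simp
  refine ⟨_, ⟨compress S.toSubmodule.subtype V, S.isCP_subtype.compress V, ?_, rfl⟩, ?_⟩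
  · rw [traceAtOne, inner_compress, inner_compress, h0, h1, Submodule.subtype_apply,
      one_apply_eq_self, one_apply_eq_self, inner_self_eq_ofReal_norm_sq,
      inner_self_eq_ofReal_norm_sq, hu, hv, Complex.ofReal_re]
    norm_num
  · rwa [reUpperRight_apply, inner_compress, h0, h1]

theorem exists_extreme_norm_le_reUpperRight [Nontrivial H] (s : S.toSubmodule) :
    ∃ g ∈ Set.extremePoints ℝ (cpTraceTwo S), ‖(s : H →L[ℂ] H)‖ ≤ reUpperRight s g := by
  have hexp := ContinuousLinearMap.toExposed.isExposed (l := reUpperRight s) (A := cpTraceTwo S)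
  obtain ⟨g₀, hg₀, -⟩ := exists_mem_cpTraceTwo_lt s (sub_one_lt ‖(s : H →L[ℂ] H)‖)
  obtain ⟨g₁, hg₁, hmax⟩ := (isCompact_cpTraceTwo S).exists_isMaxOn ⟨g₀, hg₀⟩
    (reUpperRight s).continuous.continuousOn
  obtain ⟨g, hg⟩ := (hexp.isCompact (isCompact_cpTraceTwo S)).extremePoints_nonempty
    ⟨g₁, hg₁, fun y hy => hmax hy⟩
  -- The maximizers form a compact exposed face, whose extreme points are extreme in the whole set.
  refine ⟨g, hexp.isExtreme.extremePoints_subset_extremePoints hg, ?_⟩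
  refine le_of_forall_lt fun r hr => ?_
  obtain ⟨g', hg', h⟩ := exists_mem_cpTraceTwo_lt s hr
  exact h.trans_le (hg.1.2 g' hg')

/-! ### From extreme points to pure matrix states. -/

/-- With `t = Tr χ(1) / 2`, the map `φ` is the convex combination of `χ / t` and `(φ - χ) / (1 -
t)`, both of trace two. If `t` is `0` or `1`, one summand has trace zero and vanishes. -/
theorem IsCP.eq_smul_of_mem_extremePoints {φ χ : S.toSubmodule →ₗ[ℂ] MatAlg 2}
    (hφ : ⇑φ ∈ Set.extremePoints ℝ (cpTraceTwo S)) (hχ : S.IsCP χ) (hs : S.IsCP (φ - χ)) :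
    ∃ t : ℝ, 0 ≤ t ∧ t ≤ 1 ∧ χ = (t : ℂ) • φ := by
  have zero_of {θ : S.toSubmodule →ₗ[ℂ] MatAlg 2} (h : S.IsCP θ) (h0 : traceAtOne θ = 0) :
      θ = 0 := by
    ext1 a
    have := h.norm_le_traceAtOne a
    rw [h0, mul_zero, zero_mul] at this
    simpa using this
  obtain ⟨⟨φ', -, hφ2, hφ'⟩, hext⟩ := hφ
  rw [hφ'] at hφ2
  set t := traceAtOne χ / 2 with ht
  have ht' : traceAtOne χ = 2 * t := by rw [ht]; ring
  have hsum : traceAtOne χ + traceAtOne (φ - χ : S.toSubmodule →ₗ[ℂ] MatAlg 2) = 2 := by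
    rw [← traceAtOne_add, ← hφ2]
    congr 1
    ext1 a
    simp
  have hs' : traceAtOne (φ - χ : S.toSubmodule →ₗ[ℂ] MatAlg 2) = 2 * (1 - t) := by linarith
  have h0 : 0 ≤ t := by linarith [hχ.traceAtOne_nonneg]
  have h1 : t ≤ 1 := by linarith [hs.traceAtOne_nonneg]
  refine ⟨t, h0, h1, ?_⟩
  rcases h0.eq_or_lt with h0' | h0'
  · rw [← h0', Complex.ofReal_zero, zero_smul]
    exact zero_of hχ (by rw [ht', ← h0', mul_zero])
  rcases h1.eq_or_lt with h1' | h1'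
  · have := zero_of hs (by rw [hs', h1', sub_self, mul_zero])
    rw [h1', Complex.ofReal_one, one_smul]
    exact (sub_eq_zero.1 this).symm
  have h1'' : 0 < 1 - t := sub_pos.2 h1'
  have normalize {θ : S.toSubmodule →ₗ[ℂ] MatAlg 2} {r : ℝ} (hr : 0 < r) (h : S.IsCP θ)
      (hθ : traceAtOne θ = 2 * r) : ⇑(((r⁻¹ : ℝ) : ℂ) • θ) ∈ cpTraceTwo S := by
    refine ⟨_, h.smul (inv_nonneg.2 hr.le), ?_, rfl⟩
    rw [LinearMap.coe_smul, traceAtOne_smul, hθ]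
    field_simp
  have key := hext (normalize h0' hχ ht') (normalize h1'' hs hs')
    ⟨t, 1 - t, h0', h1'', by ring, ?_⟩
  · have hc : (t : ℂ) ≠ 0 := by exact_mod_cast h0'.ne'
    rw [← DFunLike.coe_injective key, smul_smul, Complex.ofReal_inv, mul_inv_cancel₀ hc, one_smul]
  · ext1 a
    have hc : (t : ℂ) ≠ 0 := by exact_mod_cast h0'.ne'
    have hd : ((1 - t : ℝ) : ℂ) ≠ 0 := by exact_mod_cast h1''.ne'
    have real_smul (r : ℝ) (T : MatAlg 2) : r • T = (r : ℂ) • T := rfl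
    simp only [Pi.add_apply, Pi.smul_apply, LinearMap.smul_apply, LinearMap.sub_apply,
      real_smul, smul_smul, Complex.ofReal_inv, mul_inv_cancel₀ hc, mul_inv_cancel₀ hd, one_smul]
    abel

theorem exists_pureMatrixState_norm_eq [Nontrivial H] (s : S.toSubmodule) :
    ∃ k : ℕ, (k = 1 ∨ k = 2) ∧ ∃ φ ∈ S.pureMatrixStates k, ‖φ s‖ = ‖(s : H →L[ℂ] H)‖ := by
  obtain ⟨g, hg, hgs⟩ := exists_extreme_norm_le_reUpperRight s
  obtain ⟨φ, hφ, htr, rfl⟩ := hg.1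
  obtain ⟨k, hk, V, hVs, hV⟩ :=
    ContinuousLinearMap.exists_surjective_inner_eq hφ.map_one_nonneg
  rw [finrank_euclideanSpace_fin] at hk
  obtain ⟨W, hW⟩ : ∃ W : EuclideanSpace ℂ (Fin k) →L[ℂ] EuclideanSpace ℂ (Fin 2),
      ∀ x, V (W x) = x := by
    obtain ⟨W, hW⟩ := V.toLinearMap.exists_rightInverse_of_surjective
      (LinearMap.range_eq_top.2 hVs)
    exact ⟨LinearMap.toContinuousLinearMap W, fun x => LinearMap.congr_fun hW x⟩
  have htr' : ‖V (EuclideanSpace.single 0 1)‖ ^ 2 + ‖V (EuclideanSpace.single 1 1)‖ ^ 2 = 2 := by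
    rw [traceAtOne, hV, hV, inner_self_eq_ofReal_norm_sq, inner_self_eq_ofReal_norm_sq,
      Complex.ofReal_re, Complex.ofReal_re] at htr
    exact htr
  have hk0 : k ≠ 0 := by
    rintro rfl
    rw [Subsingleton.elim (V (EuclideanSpace.single 0 1)) 0,
      Subsingleton.elim (V (EuclideanSpace.single 1 1)) 0] at htr'
    norm_num at htr'
  have hker (x : EuclideanSpace ℂ (Fin 2)) : φ ⟨1, S.one_mem'⟩ (W (V x) - x) = 0 :=
    ext_inner_left ℂ fun y => by rw [hV, map_sub, hW, sub_self, inner_zero_right, inner_zero_right]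
  -- `W V x - x` lies in the kernel of `φ(1)`, which every `φ(a)` annihilates on both sides.
  have hφψ : compress (compress φ W) V = φ := by
    ext1 a
    refine ContinuousLinearMap.ext fun x => ext_inner_left ℂ fun y => ?_
    have h1 := hφ.apply_eq_zero_of_map_one (hker x) a
    have h2 := hφ.inner_apply_eq_zero_of_map_one (hker y) a x
    rw [map_sub, sub_eq_zero] at h1
    rw [inner_sub_left, sub_eq_zero] at h2
    rw [inner_compress, inner_compress, h1, h2]
  have hψ : S.IsUCP (compress φ W) := by
    refine ⟨hφ.compress W, ContinuousLinearMap.ext fun x => ext_inner_left ℂ fun y => ?_⟩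
    rw [inner_compress, hV, hW, hW, one_apply_eq_self]
  refine ⟨k, by omega, compress φ W, ⟨hψ, fun χ hχ hsub => ?_⟩,
    le_antisymm (hψ.norm_le s) (hgs.trans ?_)⟩
  -- Compressing by `V` moves `χ` below `φ`; compressing by `W` undoes this.
  · obtain ⟨t, h0, h1, ht⟩ := IsCP.eq_smul_of_mem_extremePoints hg (hχ.compress V)
      (by simpa only [compress_sub, hφψ] using hsub.compress V)
    refine ⟨t, h0, h1, ?_⟩
    rw [← compress_smul, ← ht, compress_compress_of_comp_eq_id _ hW]
  · rw [reUpperRight_apply, ← hφψ, inner_compress, hφψ]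
    set x := V (EuclideanSpace.single 0 1)
    set y := V (EuclideanSpace.single 1 1)
    -- AM-GM with `‖x‖² + ‖y‖² = 2`: the reason for normalizing the trace to two.
    have hxy : ‖x‖ * ‖y‖ ≤ 1 := by nlinarith [sq_nonneg (‖x‖ - ‖y‖)]
    calc (⟪x, compress φ W s y⟫_ℂ).re ≤ ‖⟪x, compress φ W s y⟫_ℂ‖ := Complex.re_le_norm _
      _ ≤ ‖x‖ * ‖compress φ W s y‖ := norm_inner_le_norm _ _
      _ ≤ ‖x‖ * (‖compress φ W s‖ * ‖y‖) := by gcongr; exact ContinuousLinearMap.le_opNorm _ _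
      _ = ‖compress φ W s‖ * (‖x‖ * ‖y‖) := by ring
      _ ≤ ‖compress φ W s‖ := mul_le_of_le_one_right (norm_nonneg _) hxy

end ConcreteOperatorSystem

theorem theorem2p4 {H : Type*} [NormedAddCommGroup H] [InnerProductSpace ℂ H] [CompleteSpace H]
    [Nontrivial H] (S : ConcreteOperatorSystem H) :
    (∀ s : S.toSubmodule, ∃ k : ℕ, (k = 1 ∨ k = 2) ∧
      ∃ φ ∈ S.pureMatrixStates k, ‖φ s‖ = ‖(s : H →L[ℂ] H)‖) ∧
    (∀ n : ℕ, 1 ≤ n → ∀ x : (S.matrixSystem n).toSubmodule,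
      IsGreatest
        {r : ℝ | ∃ k : ℕ, 1 ≤ k ∧ ∃ φ ∈ (S.matrixSystem n).pureMatrixStates k, ‖φ x‖ = r}
        ‖(x : HilbertPower H n →L[ℂ] HilbertPower H n)‖) := by
  refine ⟨S.exists_pureMatrixState_norm_eq, fun n hn x => ⟨?_, ?_⟩⟩
  · have : Nonempty (Fin n) := ⟨⟨0, hn⟩⟩
    have : Nontrivial (HilbertPower H n) := (WithLp.equiv 2 (Fin n → H)).nontrivial
    obtain ⟨k, hk, φ, hφ, h⟩ := (S.matrixSystem n).exists_pureMatrixState_norm_eq x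
    exact ⟨k, by omega, φ, hφ, h⟩
  · rintro r ⟨k, -, φ, hφ, rfl⟩
    exact hφ.1.norm_le x
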